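/- Let $n,p$ be natural numbers with $n-p-1>0$, let $M\in\mathbb{R}^{n\times p}$, and let $X$ be a random $n\times p$ matrix whose entries are independent with $X_{ij}\sim \mathrm{N}(M_{ij},1)$. Let $$\hat M_{\mathrm{EM}} = X\bigl(I_p-(n-p-1)(X^\top X)^{-1}\bigr)$$ be the Efron--Morris estimator (well defined almost surely), and let $\hat M_{C_*}=XC_*$ be the linear oracle estimator, where $$C_*=C_*(M)=(M^\top M+nI_p)^{-1}M^\top M .$$ Then the matrix quadratic risks of both estimators are finite (all entries of the matrices $(\hat M-M)^\top(\hat M-M)$ are integrable), and $$\mathrm{E}_M\bigl[(\hat M_{\mathrm{EM}}-M)^\top(\hat M_{\mathrm{EM}}-M)\bigr]\preceq \mathrm{E}_M\bigl[(\hat M_{C_*}-M)^\top(\hat M_{C_*}-M)\bigr]+2(p+1)I_p ,$$ where $\mathrm{E}_M$ is the entrywise expectation and $A\preceq B$ means that $B-A$ is positive semidefinite. This holds for every $M$. -/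

import Mathlib

open MeasureTheory ProbabilityTheory Matrix

open scoped MatrixOrder

noncomputable section

/-- The matrix quadratic loss `(Mhat - M)ᵀ (Mhat - M)`. -/
def matrixQuadraticLoss {n p : ℕ} (M Mhat : Matrix (Fin n) (Fin p) ℝ) :
    Matrix (Fin p) (Fin p) ℝ :=
  (Mhat - M)ᵀ * (Mhat - M)

/-- Entrywise expectation of a random matrix. -/
def matrixExpectation {Ω : Type*} [MeasurableSpace Ω] {p : ℕ} (P : Measure Ω)
    (Y : Ω → Matrix (Fin p) (Fin p) ℝ) : Matrix (Fin p) (Fin p) ℝ :=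
  Matrix.of fun i j => ∫ ω, Y ω i j ∂P

/-- The matrix quadratic risk of the estimator `δ` of `M` based on the observation `X`. -/
def matrixQuadraticRisk {Ω : Type*} [MeasurableSpace Ω] {n p : ℕ} (P : Measure Ω)
    (X : Ω → Matrix (Fin n) (Fin p) ℝ) (M : Matrix (Fin n) (Fin p) ℝ)
    (δ : Matrix (Fin n) (Fin p) ℝ → Matrix (Fin n) (Fin p) ℝ) : Matrix (Fin p) (Fin p) ℝ :=
  matrixExpectation P fun ω => matrixQuadraticLoss M (δ (X ω))

/-- All entries of the matrix quadratic loss of `δ` are integrable, so that the risk of `δ`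
is a genuine finite expectation. -/
def HasFiniteMatrixRisk {Ω : Type*} [MeasurableSpace Ω] {n p : ℕ} (P : Measure Ω)
    (X : Ω → Matrix (Fin n) (Fin p) ℝ) (M : Matrix (Fin n) (Fin p) ℝ)
    (δ : Matrix (Fin n) (Fin p) ℝ → Matrix (Fin n) (Fin p) ℝ) : Prop :=
  ∀ i j, Integrable (fun ω => matrixQuadraticLoss M (δ (X ω)) i j) P

/-- The Efron–Morris estimator `x (I - (n - p - 1) (xᵀ x)⁻¹)`. -/
def efronMorris {n p : ℕ} (x : Matrix (Fin n) (Fin p) ℝ) : Matrix (Fin n) (Fin p) ℝ :=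
  x * (1 - ((n : ℝ) - (p : ℝ) - 1) • (xᵀ * x)⁻¹)

/-- The linear estimator `x C`. -/
def linearEstimator {n p : ℕ} (C : Matrix (Fin p) (Fin p) ℝ) (x : Matrix (Fin n) (Fin p) ℝ) :
    Matrix (Fin n) (Fin p) ℝ :=
  x * C

/-- The oracle coefficient matrix `(Mᵀ M + n I)⁻¹ Mᵀ M`. -/
def oracleCoeff {n p : ℕ} (M : Matrix (Fin n) (Fin p) ℝ) : Matrix (Fin p) (Fin p) ℝ :=
  (Mᵀ * M + (n : ℝ) • (1 : Matrix (Fin p) (Fin p) ℝ))⁻¹ * (Mᵀ * M)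

end

theorem hasDerivAt_gaussianPDFReal_one (m x : ℝ) :
    HasDerivAt (gaussianPDFReal m 1) (-(x - m) * gaussianPDFReal m 1 x) x := by
  have h1 : HasDerivAt (fun y : ℝ => -(y - m) ^ 2 / 2) (-(x - m)) x := by
    have := (((hasDerivAt_id x).sub_const m).pow 2).neg.div_const 2
    refine this.congr_deriv ?_
    simp only [id_eq]
    ring
  have h2 := (h1.exp).const_mul ((√(2 * Real.pi * (1 : NNReal)))⁻¹)
  have e : gaussianPDFReal m 1 =
      fun y => (√(2 * Real.pi * (1 : NNReal)))⁻¹ * Real.exp (-(y - m) ^ 2 / 2) := by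
    ext y; simp [gaussianPDFReal]
  rw [e]
  exact h2.congr_deriv (by ring)

/-- Stein's identity for a one-dimensional Gaussian variable with unit variance. -/
theorem integral_sub_mean_mul_gaussianReal {m C : ℝ} {f f' : ℝ → ℝ}
    (hf : ∀ x, HasDerivAt f (f' x) x) (hC : ∀ x, |f x| ≤ C) (hC' : ∀ x, |f' x| ≤ C) :
    ∫ x, (x - m) * f x ∂gaussianReal m 1 = ∫ x, f' x ∂gaussianReal m 1 := by
  have hfm : Measurable f :=
    (continuous_iff_continuousAt.2 fun x => (hf x).continuousAt).measurable
  have hf'm : Measurable f' := by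
    have : f' = deriv f := funext fun x => (hf x).deriv.symm
    rw [this]; exact measurable_deriv f
  have hφ := integrable_gaussianPDFReal m 1
  have hid : Integrable (fun x => (x - m) * gaussianPDFReal m 1 x) := by
    have h : Integrable (fun x : ℝ => x - m) (gaussianReal m 1) :=
      ((memLp_id_gaussianReal (μ := m) (v := 1) 1).integrable le_rfl).sub (integrable_const m)
    rw [gaussianReal_of_var_ne_zero m one_ne_zero,
      integrable_withDensity_iff (measurable_gaussianPDF m 1)
        (ae_of_all _ fun x => gaussianPDF_lt_top)] at h
    simpa [toReal_gaussianPDF] using h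
  have i1 : Integrable (f * fun x => -(x - m) * gaussianPDFReal m 1 x) := by
    have := hid.neg.bdd_mul (c := C) hfm.aestronglyMeasurable (ae_of_all _ hC)
    refine this.congr (ae_of_all _ fun x => ?_)
    simp only [Pi.neg_apply, Pi.mul_apply]
    ring
  have i2 : Integrable (f' * gaussianPDFReal m 1) :=
    hφ.bdd_mul (c := C) hf'm.aestronglyMeasurable (ae_of_all _ hC')
  have i3 : Integrable (f * gaussianPDFReal m 1) :=
    hφ.bdd_mul (c := C) hfm.aestronglyMeasurable (ae_of_all _ hC)
  have key := integral_mul_deriv_eq_deriv_mul_of_integrable (fun x _ => hf x)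
    (fun x _ => hasDerivAt_gaussianPDFReal_one m x) i1 i2 i3
  rw [integral_gaussianReal_eq_integral_smul one_ne_zero,
    integral_gaussianReal_eq_integral_smul one_ne_zero]
  simp only [smul_eq_mul]
  have e1 : ∫ x, gaussianPDFReal m 1 x * ((x - m) * f x) =
      -∫ x, f x * (-(x - m) * gaussianPDFReal m 1 x) := by
    rw [← integral_neg]; congr 1; ext x; ring
  rw [e1, key, neg_neg]
  congr 1; ext x; ring

/-- Resampling one coordinate of a product of probability measures leaves the product unchanged. -/
theorem measurePreserving_update_pi {ι : Type*} [Fintype ι] [DecidableEq ι] {α : ι → Type*}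
    [∀ i, MeasurableSpace (α i)] (μ : ∀ i, Measure (α i)) [∀ i, IsProbabilityMeasure (μ i)]
    (i : ι) :
    MeasurePreserving (fun q : (∀ j, α j) × α i => Function.update q.1 i q.2)
      ((Measure.pi μ).prod (μ i)) (Measure.pi μ) := by
  have hm : Measurable (fun q : (∀ j, α j) × α i => Function.update q.1 i q.2) := by
    refine measurable_pi_lambda _ fun j => ?_
    by_cases h : j = i
    · subst h; simpa using measurable_snd
    · simpa [Function.update_of_ne h, Function.comp_def] using
        (measurable_pi_apply j).comp measurable_fst
  refine ⟨hm, ?_⟩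
  symm
  refine Measure.pi_eq fun s hs => ?_
  rw [Measure.map_apply hm (MeasurableSet.univ_pi hs)]
  have : (fun q : (∀ j, α j) × α i => Function.update q.1 i q.2) ⁻¹' (Set.univ.pi s) =
      (Set.univ.pi (Function.update s i Set.univ)) ×ˢ (s i) := by
    ext ⟨x, t⟩
    simp only [Set.mem_preimage, Set.mem_pi, Set.mem_univ, true_implies, Set.mem_prod]
    constructor
    · intro h
      refine ⟨fun j => ?_, by simpa using h i⟩
      by_cases hj : j = i
      · subst hj; simp
      · simpa [Function.update_of_ne hj] using h j
    · rintro ⟨h, ht⟩ j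
      by_cases hj : j = i
      · subst hj; simpa using ht
      · simpa [Function.update_of_ne hj] using h j
  rw [this, Measure.prod_prod, Measure.pi_pi, ← Finset.prod_erase_mul _ _ (Finset.mem_univ i),
    ← Finset.prod_erase_mul (f := fun j => μ j (s j)) _ (Finset.mem_univ i)]
  simp only [Function.update_self, measure_univ, mul_one]
  congr 1
  refine Finset.prod_congr rfl fun j hj => ?_
  rw [Function.update_of_ne (Finset.ne_of_mem_erase hj)]

/-- Stein's identity in one coordinate of a Gaussian vector with independent entries. -/
theorem integral_sub_mean_mul_pi_gaussianReal {ι : Type*} [Fintype ι] [DecidableEq ι]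
    {m : ι → ℝ} {C : ℝ} {f f' : (ι → ℝ) → ℝ} (i : ι)
    (hf : ∀ x t, HasDerivAt (fun s => f (Function.update x i s)) (f' (Function.update x i t)) t)
    (hfm : Measurable f) (hf'm : Measurable f') (hC : ∀ x, |f x| ≤ C) (hC' : ∀ x, |f' x| ≤ C) :
    ∫ x, (x i - m i) * f x ∂Measure.pi (fun j => gaussianReal (m j) 1) =
      ∫ x, f' x ∂Measure.pi (fun j => gaussianReal (m j) 1) := by
  set μ := Measure.pi (fun j => gaussianReal (m j) 1)
  have hmp := measurePreserving_update_pi (fun j => gaussianReal (m j) 1) i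
  have hid : Integrable (fun x : ι → ℝ => x i - m i) μ :=
    ((measurePreserving_eval (fun j => gaussianReal (m j) 1) i).integrable_comp_of_integrable
      ((memLp_id_gaussianReal (μ := m i) (v := 1) 1).integrable le_rfl)).sub (integrable_const _)
  have i1 : Integrable (fun x : ι → ℝ => (x i - m i) * f x) μ :=
    hid.mul_bdd (c := C) hfm.aestronglyMeasurable (ae_of_all _ hC)
  have i2 : Integrable f' μ :=
    Integrable.of_bound hf'm.aestronglyMeasurable C (ae_of_all _ hC')
  have transfer : ∀ g : (ι → ℝ) → ℝ, Integrable g μ →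
      ∫ x, g x ∂μ = ∫ x, ∫ t, g (Function.update x i t) ∂gaussianReal (m i) 1 ∂μ := by
    intro g hg
    have h1 := integral_map hmp.measurable.aemeasurable
      (f := g) (by rw [hmp.map_eq]; exact hg.aestronglyMeasurable)
    rw [hmp.map_eq] at h1
    exact h1.trans (integral_prod _ (hmp.integrable_comp_of_integrable hg))
  rw [transfer _ i1, transfer _ i2]
  congr 1
  ext x
  simp only [Function.update_self]
  exact integral_sub_mean_mul_gaussianReal (hf x) (fun t => hC _) (fun t => hC' _)

section
open scoped Matrix.Norms.Operator

theorem hasDerivAt_matrix_inv_apply {κ : Type*} [Fintype κ] [DecidableEq κ]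
    {B : ℝ → Matrix κ κ ℝ} {B' : Matrix κ κ ℝ} {t : ℝ}
    (hB : ∀ k l, HasDerivAt (fun s => B s k l) (B' k l) t) (hu : IsUnit (B t)) (k l : κ) :
    HasDerivAt (fun s => (B s)⁻¹ k l) (-((B t)⁻¹ * B' * (B t)⁻¹) k l) t := by
  have hB' : HasDerivAt B B' t :=
    hasDerivAt_pi.2 fun k => hasDerivAt_pi.2 fun l => hB k l
  obtain ⟨u, hu⟩ := hu
  have h1 := hasFDerivAt_ringInverse (𝕜 := ℝ) u
  rw [hu] at h1
  have h2 := h1.comp_hasDerivAt t hB'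
  have h3 := hasDerivAt_pi.1 (hasDerivAt_pi.1 h2 k) l
  simp only [nonsing_inv_eq_ringInverse]
  refine h3.congr_deriv ?_
  rw [← hu, Ring.inverse_unit]
  simp only [_root_.neg_apply, ContinuousLinearMap.mulLeftRight_apply, Matrix.neg_apply]

end

section ridgeInv

variable {ι κ : Type*} [Fintype ι] [Fintype κ] [DecidableEq κ]

/-- The regularized inverse Gram matrix `(xᵀ x + ε I)⁻¹`. -/
noncomputable def ridgeInv (ε : ℝ) (x : Matrix ι κ ℝ) : Matrix κ κ ℝ :=
  (xᵀ * x + ε • (1 : Matrix κ κ ℝ))⁻¹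

variable {ε : ℝ}

theorem posDef_gram_add_smul_one (hε : 0 < ε) (x : Matrix ι κ ℝ) :
    (xᵀ * x + ε • (1 : Matrix κ κ ℝ)).PosDef := by
  refine Matrix.PosDef.posSemidef_add ?_ (Matrix.PosDef.one.smul hε)
  simpa using Matrix.posSemidef_conjTranspose_mul_self x

theorem isUnit_gram_add_smul_one (hε : 0 < ε) (x : Matrix ι κ ℝ) :
    IsUnit (xᵀ * x + ε • (1 : Matrix κ κ ℝ)) :=
  (posDef_gram_add_smul_one hε x).isUnit

theorem gram_add_smul_one_mul_ridgeInv (hε : 0 < ε) (x : Matrix ι κ ℝ) :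
    (xᵀ * x + ε • (1 : Matrix κ κ ℝ)) * ridgeInv ε x = 1 :=
  Matrix.mul_nonsing_inv _ ((Matrix.isUnit_iff_isUnit_det _).1 (isUnit_gram_add_smul_one hε x))

theorem gram_mulVec_ridgeInv_mulVec (hε : 0 < ε) (x : Matrix ι κ ℝ) (v : κ → ℝ) :
    xᵀ *ᵥ (x *ᵥ (ridgeInv ε x *ᵥ v)) = v - ε • (ridgeInv ε x *ᵥ v) := by
  have h := congrArg (· *ᵥ v) (gram_add_smul_one_mul_ridgeInv hε x)
  simp only [add_mul, add_mulVec, one_mulVec, ← mulVec_mulVec, smul_mulVec] at h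
  exact eq_sub_of_add_eq h

theorem dotProduct_ridgeInv_mulVec (hε : 0 < ε) (x : Matrix ι κ ℝ) (v w : κ → ℝ) :
    v ⬝ᵥ (ridgeInv ε x *ᵥ w) =
      (x *ᵥ (ridgeInv ε x *ᵥ v)) ⬝ᵥ (x *ᵥ (ridgeInv ε x *ᵥ w)) +
        ε * ((ridgeInv ε x *ᵥ v) ⬝ᵥ (ridgeInv ε x *ᵥ w)) := by
  have h : v = xᵀ *ᵥ (x *ᵥ (ridgeInv ε x *ᵥ v)) + ε • (ridgeInv ε x *ᵥ v) := by
    rw [gram_mulVec_ridgeInv_mulVec hε]; abel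
  conv_lhs => rw [h]
  rw [add_dotProduct, smul_dotProduct, smul_eq_mul, mulVec_transpose,
    ← dotProduct_mulVec]

theorem dotProduct_self_nonneg_real {α : Type*} [Fintype α] (v : α → ℝ) : 0 ≤ v ⬝ᵥ v :=
  Finset.sum_nonneg fun _ _ => mul_self_nonneg _

theorem sq_apply_le_dotProduct_self {α : Type*} [Fintype α] (v : α → ℝ) (a : α) :
    v a ^ 2 ≤ v ⬝ᵥ v := by
  rw [sq]
  exact Finset.single_le_sum (f := fun a => v a * v a) (fun _ _ => mul_self_nonneg _)
    (Finset.mem_univ a)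

theorem ridgeInv_quadratic_nonneg (hε : 0 < ε) (x : Matrix ι κ ℝ) (v : κ → ℝ) :
    0 ≤ v ⬝ᵥ (ridgeInv ε x *ᵥ v) := by
  rw [dotProduct_ridgeInv_mulVec hε]
  have := dotProduct_self_nonneg_real (x *ᵥ (ridgeInv ε x *ᵥ v))
  have := dotProduct_self_nonneg_real (ridgeInv ε x *ᵥ v)
  positivity

theorem ridgeInv_quadratic_le (hε : 0 < ε) (x : Matrix ι κ ℝ) (v : κ → ℝ) :
    ε * (v ⬝ᵥ (ridgeInv ε x *ᵥ v)) ≤ v ⬝ᵥ v := by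
  have h1 := dotProduct_ridgeInv_mulVec hε x v v
  have h2 := dotProduct_self_nonneg_real (x *ᵥ (ridgeInv ε x *ᵥ v))
  have h3 := dotProduct_self_nonneg_real (v - ε • (ridgeInv ε x *ᵥ v))
  simp only [sub_dotProduct, dotProduct_sub, smul_dotProduct, dotProduct_smul, smul_eq_mul,
    dotProduct_comm (ridgeInv ε x *ᵥ v) v] at h3
  nlinarith [mul_nonneg hε.le h2]

theorem sq_mulVec_ridgeInv_le (hε : 0 < ε) (x : Matrix ι κ ℝ) (v : κ → ℝ) (i : ι) :
    (x *ᵥ (ridgeInv ε x *ᵥ v)) i ^ 2 ≤ v ⬝ᵥ v / ε := by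
  refine (sq_apply_le_dotProduct_self _ i).trans ?_
  rw [le_div_iff₀ hε]
  have h1 := dotProduct_ridgeInv_mulVec hε x v v
  have h2 := ridgeInv_quadratic_le hε x v
  have h3 := dotProduct_self_nonneg_real (ridgeInv ε x *ᵥ v)
  nlinarith [mul_nonneg (mul_nonneg hε.le hε.le) h3]

theorem sq_ridgeInv_mulVec_le (hε : 0 < ε) (x : Matrix ι κ ℝ) (v : κ → ℝ) (j : κ) :
    (ridgeInv ε x *ᵥ v) j ^ 2 ≤ v ⬝ᵥ v / ε ^ 2 := by
  refine (sq_apply_le_dotProduct_self _ j).trans ?_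
  rw [le_div_iff₀ (by positivity)]
  have h1 := dotProduct_ridgeInv_mulVec hε x v v
  have h2 := ridgeInv_quadratic_le hε x v
  have h3 := dotProduct_self_nonneg_real (x *ᵥ (ridgeInv ε x *ᵥ v))
  nlinarith [mul_nonneg hε.le h3]

/-- The `i`-th leverage score `xᵢ (xᵀ x + ε I)⁻¹ xᵢᵀ`. -/
noncomputable def leverage (ε : ℝ) (x : Matrix ι κ ℝ) (i : ι) : ℝ :=
  x i ⬝ᵥ (ridgeInv ε x *ᵥ x i)

theorem leverage_nonneg (hε : 0 < ε) (x : Matrix ι κ ℝ) (i : ι) : 0 ≤ leverage ε x i :=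
  ridgeInv_quadratic_nonneg hε x _

theorem sum_leverage_le (hε : 0 < ε) (x : Matrix ι κ ℝ) :
    ∑ i, leverage ε x i ≤ Fintype.card κ := by
  have h1 : ∑ i, leverage ε x i = (xᵀ * x * ridgeInv ε x).trace := by
    rw [Matrix.mul_assoc, Matrix.trace_mul_comm, Matrix.mul_assoc]
    have : ∀ i, leverage ε x i = (x * (ridgeInv ε x * xᵀ)) i i := by
      intro i
      simp [leverage, Matrix.mul_apply, dotProduct, mulVec]
    simp [Matrix.trace, this, ← Matrix.mul_assoc]
  have h2 : xᵀ * x * ridgeInv ε x = 1 - ε • ridgeInv ε x := by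
    have := gram_add_smul_one_mul_ridgeInv hε x
    rw [add_mul, smul_mul_assoc, one_mul] at this
    rw [← this]; abel
  have h3 : 0 ≤ (ridgeInv ε x).trace := by
    refine Finset.sum_nonneg fun j _ => ?_
    simpa using ridgeInv_quadratic_nonneg hε x (Pi.single j 1)
  rw [h1, h2, Matrix.trace_sub, Matrix.trace_one, Matrix.trace_smul, smul_eq_mul]
  nlinarith [mul_nonneg hε.le h3]

theorem leverage_le (hε : 0 < ε) (x : Matrix ι κ ℝ) (i : ι) :
    leverage ε x i ≤ Fintype.card κ :=
  (Finset.single_le_sum (fun i _ => leverage_nonneg hε x i) (Finset.mem_univ i)).trans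
    (sum_leverage_le hε x)

/-- The partial derivative of the `i`-th entry of `x (xᵀ x + ε I)⁻¹ v` in direction `(i, j)`. -/
noncomputable def ridgePartial (ε : ℝ) (v : κ → ℝ) (i : ι) (j : κ) (x : Matrix ι κ ℝ) : ℝ :=
  (ridgeInv ε x *ᵥ v) j
    - (x *ᵥ (ridgeInv ε x *ᵥ Pi.single j 1)) i * (x *ᵥ (ridgeInv ε x *ᵥ v)) i
    - leverage ε x i * (ridgeInv ε x *ᵥ v) j

theorem exists_bound_ridge (hε : 0 < ε) (v : κ → ℝ) :
    ∃ C : ℝ, ∀ (i : ι) (j : κ) (x : Matrix ι κ ℝ),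
    |(x *ᵥ (ridgeInv ε x *ᵥ v)) i| ≤ C ∧ |ridgePartial ε v i j x| ≤ C := by
  set a := √(v ⬝ᵥ v / ε)
  set b := √(v ⬝ᵥ v / ε ^ 2)
  set d := √(1 / ε)
  have ha : 0 ≤ a := Real.sqrt_nonneg _
  have hb : 0 ≤ b := Real.sqrt_nonneg _
  have hd : 0 ≤ d := Real.sqrt_nonneg _
  refine ⟨a + (b + d * a + Fintype.card κ * b), fun i j x => ?_⟩
  have h1 : |(x *ᵥ (ridgeInv ε x *ᵥ v)) i| ≤ a := Real.abs_le_sqrt (sq_mulVec_ridgeInv_le hε x v i)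
  have h2 : |(ridgeInv ε x *ᵥ v) j| ≤ b := Real.abs_le_sqrt (sq_ridgeInv_mulVec_le hε x v j)
  have h3 : |(x *ᵥ (ridgeInv ε x *ᵥ Pi.single j 1)) i| ≤ d := by
    refine Real.abs_le_sqrt ((sq_mulVec_ridgeInv_le hε x _ i).trans (le_of_eq ?_))
    simp
  have h4 : |leverage ε x i| ≤ Fintype.card κ := by
    rw [abs_of_nonneg (leverage_nonneg hε x i)]; exact leverage_le hε x i
  have h5 : |ridgePartial ε v i j x| ≤ b + d * a + Fintype.card κ * b := by
    refine (abs_sub _ _).trans (add_le_add ((abs_sub _ _).trans (add_le_add h2 ?_)) ?_)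
    · rw [abs_mul]; gcongr
    · rw [abs_mul]; gcongr
  have : 0 ≤ b + d * a + Fintype.card κ * b := by positivity
  constructor <;> linarith

theorem sum_ridgePartial (v : κ → ℝ) (x : Matrix ι κ ℝ) :
    ∑ i, ∑ j, v j * ridgePartial ε v i j x =
      (Fintype.card ι - ∑ i, leverage ε x i) * (v ⬝ᵥ (ridgeInv ε x *ᵥ v)) -
        (x *ᵥ (ridgeInv ε x *ᵥ v)) ⬝ᵥ (x *ᵥ (ridgeInv ε x *ᵥ v)) := by
  have h : ∀ i, ∑ j, v j * ridgePartial ε v i j x =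
      (1 - leverage ε x i) * (v ⬝ᵥ (ridgeInv ε x *ᵥ v)) -
        (x *ᵥ (ridgeInv ε x *ᵥ v)) i * (x *ᵥ (ridgeInv ε x *ᵥ v)) i := by
    intro i
    have h1 : ∑ j, v j * (x *ᵥ (ridgeInv ε x *ᵥ Pi.single j 1)) i =
        (x *ᵥ (ridgeInv ε x *ᵥ v)) i := by
      simp only [mulVec_mulVec, mulVec_single_one]
      exact Finset.sum_congr rfl fun j _ => mul_comm _ _
    simp only [ridgePartial, mul_sub, Finset.sum_sub_distrib]
    have h2 : ∑ j, v j * ((x *ᵥ (ridgeInv ε x *ᵥ Pi.single j 1)) i *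
        (x *ᵥ (ridgeInv ε x *ᵥ v)) i) =
        (x *ᵥ (ridgeInv ε x *ᵥ v)) i * (x *ᵥ (ridgeInv ε x *ᵥ v)) i := by
      simp only [← mul_assoc, ← Finset.sum_mul, h1]
    have h3 : ∑ j, v j * (leverage ε x i * (ridgeInv ε x *ᵥ v) j) =
        leverage ε x i * (v ⬝ᵥ (ridgeInv ε x *ᵥ v)) := by
      rw [dotProduct, Finset.mul_sum]
      exact Finset.sum_congr rfl fun _ _ => by ring
    rw [h2, h3, ← dotProduct]
    ring
  simp only [h, Finset.sum_sub_distrib, ← Finset.sum_mul, Finset.sum_const, Finset.card_univ,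
    nsmul_eq_mul, mul_one]
  rfl

/-- The divergence appearing in Stein's identity dominates `(n - p - 1) v (xᵀ x + ε I)⁻¹ v`. -/
theorem le_sum_ridgePartial (hε : 0 < ε) (v : κ → ℝ) (x : Matrix ι κ ℝ) :
    ((Fintype.card ι : ℝ) - Fintype.card κ - 1) * (v ⬝ᵥ (ridgeInv ε x *ᵥ v)) ≤
      ∑ i, ∑ j, v j * ridgePartial ε v i j x := by
  rw [sum_ridgePartial]
  have h1 := dotProduct_ridgeInv_mulVec hε x v v
  have h2 := dotProduct_self_nonneg_real (ridgeInv ε x *ᵥ v)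
  have h3 := sum_leverage_le hε x
  nlinarith [mul_nonneg hε.le h2, mul_nonneg (sub_nonneg.2 h3) (ridgeInv_quadratic_nonneg hε x v)]

/-- The tangent line inequality behind the operator convexity of the inverse. -/
theorem le_ridgeInv_quadratic (hε : 0 < ε) (x : Matrix ι κ ℝ) (v w : κ → ℝ) :
    2 * (v ⬝ᵥ w) - ((x *ᵥ w) ⬝ᵥ (x *ᵥ w) + ε * (w ⬝ᵥ w)) ≤ v ⬝ᵥ (ridgeInv ε x *ᵥ v) := by
  set r := ridgeInv ε x *ᵥ v with hr
  have h1 := dotProduct_ridgeInv_mulVec hε x v v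
  rw [← hr] at h1
  have h2 := dotProduct_self_nonneg_real (x *ᵥ (r - w))
  have h3 := dotProduct_self_nonneg_real (r - w)
  have h4 : v ⬝ᵥ w = (x *ᵥ r) ⬝ᵥ (x *ᵥ w) + ε * (r ⬝ᵥ w) := by
    have h : v = xᵀ *ᵥ (x *ᵥ r) + ε • r := by
      rw [hr, gram_mulVec_ridgeInv_mulVec hε]; abel
    conv_lhs => rw [h]
    rw [add_dotProduct, smul_dotProduct, smul_eq_mul, mulVec_transpose, ← dotProduct_mulVec]
  simp only [mulVec_sub, sub_dotProduct, dotProduct_sub, dotProduct_comm (x *ᵥ w) (x *ᵥ r),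
    dotProduct_comm w r] at h2 h3
  nlinarith [mul_nonneg hε.le h3]

theorem hasDerivAt_ridge [DecidableEq ι] (hε : 0 < ε) (v : κ → ℝ) (i : ι) (j : κ)
    {x : ℝ → Matrix ι κ ℝ} {t : ℝ}
    (hx : ∀ a b, HasDerivAt (fun s => x s a b) (Matrix.single i j (1 : ℝ) a b) t) :
    HasDerivAt (fun s => (x s *ᵥ (ridgeInv ε (x s) *ᵥ v)) i) (ridgePartial ε v i j (x t)) t := by
  set E : Matrix ι κ ℝ := Matrix.single i j (1 : ℝ) with hE
  set R := ridgeInv ε (x t) with hR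
  have hB : ∀ k l, HasDerivAt (fun s => ((x s)ᵀ * x s + ε • (1 : Matrix κ κ ℝ)) k l)
      ((Eᵀ * x t + (x t)ᵀ * E) k l) t := by
    intro k l
    simp only [Matrix.add_apply, Matrix.mul_apply, Matrix.transpose_apply, ← Finset.sum_add_distrib]
    exact (HasDerivAt.fun_sum fun a _ => (hx a k).mul (hx a l)).add_const _
  have hR' := hasDerivAt_matrix_inv_apply hB (isUnit_gram_add_smul_one hε (x t))
  have hRv : ∀ k, HasDerivAt (fun s => (ridgeInv ε (x s) *ᵥ v) k)
      (-((R * (Eᵀ * x t + (x t)ᵀ * E) * R) *ᵥ v) k) t := by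
    intro k
    simp only [mulVec, dotProduct, ← Finset.sum_neg_distrib]
    refine HasDerivAt.fun_sum fun l _ => ?_
    exact ((hR' k l).mul_const (v l)).congr_deriv (by simp [hR, ridgeInv])
  have h : HasDerivAt (fun s => (x s *ᵥ (ridgeInv ε (x s) *ᵥ v)) i)
      (∑ k, (E i k * (R *ᵥ v) k + x t i k * -((R * (Eᵀ * x t + (x t)ᵀ * E) * R) *ᵥ v) k)) t := by
    simp only [mulVec, dotProduct]
    exact HasDerivAt.fun_sum fun k _ => (hx i k).mul (hRv k)
  refine h.congr_deriv ?_
  have hEv : ∀ w : κ → ℝ, E *ᵥ w = Pi.single i (w j) := by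
    intro w; ext a
    by_cases ha : a = i
    · subst ha; simp [hE, single_mulVec]
    · simp [hE, single_mulVec, ha]
  have hEtv : ∀ w : ι → ℝ, Eᵀ *ᵥ w = Pi.single j (w i) := by
    intro w; ext a
    by_cases ha : a = j
    · subst ha; simp [hE, single_mulVec]
    · simp [hE, single_mulVec, ha]
  have e1 : ∑ k, (E i k * (R *ᵥ v) k + x t i k * -((R * (Eᵀ * x t + (x t)ᵀ * E) * R) *ᵥ v) k) =
      (E *ᵥ (R *ᵥ v)) i - (x t *ᵥ (R *ᵥ (Eᵀ *ᵥ (x t *ᵥ (R *ᵥ v))))) i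
        - (x t *ᵥ (R *ᵥ ((x t)ᵀ *ᵥ (E *ᵥ (R *ᵥ v))))) i := by
    rw [Finset.sum_add_distrib]
    have : ∑ k, x t i k * -((R * (Eᵀ * x t + (x t)ᵀ * E) * R) *ᵥ v) k =
        -(x t *ᵥ ((R * (Eᵀ * x t + (x t)ᵀ * E) * R) *ᵥ v)) i := by
      simp [mulVec, dotProduct]
    rw [this]
    simp only [← mulVec_mulVec, add_mulVec, mulVec_add, Pi.add_apply]
    simp only [mulVec, dotProduct]
    ring
  rw [e1, hEv, hEtv]
  have e2 : ∀ (c : ℝ) (j : κ), (Pi.single j c : κ → ℝ) = c • Pi.single j 1 := by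
    intro c j; ext; simp [Pi.single_apply]
  have e3 : (x t)ᵀ *ᵥ (Pi.single i ((R *ᵥ v) j)) = (R *ᵥ v) j • x t i := by
    ext; simp [mul_comm]
  rw [e3, e2]
  simp only [mulVec_smul, Pi.smul_apply, smul_eq_mul, Pi.single_eq_same, ridgePartial, leverage,
    ← hR]
  have e4 : (x t *ᵥ (R *ᵥ x t i)) i = x t i ⬝ᵥ (R *ᵥ x t i) := rfl
  rw [e4]
  ring

end ridgeInv

theorem measurable_matrix_inv_apply {α κ : Type*} [TopologicalSpace α] [MeasurableSpace α]
    [OpensMeasurableSpace α] [Fintype κ] [DecidableEq κ] {A : α → Matrix κ κ ℝ}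
    (hA : Continuous A) (k l : κ) : Measurable fun a => (A a)⁻¹ k l := by
  simp only [Matrix.inv_def, Ring.inverse_eq_inv', Matrix.smul_apply, smul_eq_mul]
  exact hA.matrix_det.measurable.inv.mul (hA.matrix_adjugate.matrix_elem k l).measurable

theorem tendsto_inv_add_smul_one {κ : Type*} [Fintype κ] [DecidableEq κ] {A : Matrix κ κ ℝ}
    (hA : A.det ≠ 0) :
    Filter.Tendsto (fun ε : ℝ => (A + ε • (1 : Matrix κ κ ℝ))⁻¹) (nhds 0) (nhds A⁻¹) := by
  have hc : Continuous fun ε : ℝ => A + ε • (1 : Matrix κ κ ℝ) := by fun_prop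
  have hd := hc.matrix_det.tendsto 0
  have ha := hc.matrix_adjugate.tendsto 0
  simp only [zero_smul, add_zero] at hd ha
  simp only [Matrix.inv_def, Ring.inverse_eq_inv']
  exact (hd.inv₀ hA).smul ha

theorem measurable_mulVec_apply {α β γ : Type*} [MeasurableSpace α] [Fintype γ]
    {A : α → Matrix β γ ℝ} {w : α → γ → ℝ} (hA : ∀ b c, Measurable fun a => A a b c)
    (hw : ∀ c, Measurable fun a => w a c) (b : β) : Measurable fun a => (A a *ᵥ w a) b :=
  Finset.measurable_fun_sum _ fun c _ => (hA b c).mul (hw c)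

theorem measurable_dotProduct {α γ : Type*} [MeasurableSpace α] [Fintype γ]
    {v w : α → γ → ℝ} (hv : ∀ c, Measurable fun a => v a c)
    (hw : ∀ c, Measurable fun a => w a c) : Measurable fun a => v a ⬝ᵥ w a :=
  Finset.measurable_fun_sum _ fun c _ => (hv c).mul (hw c)

theorem integrable_dotProduct_self {α γ : Type*} [MeasurableSpace α] {μ : Measure α} [Fintype γ]
    {f : α → γ → ℝ} (hf : ∀ c, MemLp (fun a => f a c) 2 μ) :
    Integrable (fun a => f a ⬝ᵥ f a) μ :=
  integrable_finsetSum _ fun c _ => (hf c).integrable_mul (hf c)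

section gaussianMatrix

variable {ι κ : Type*}

/-- The matrix with prescribed entries. -/
def ofEntries (y : ι × κ → ℝ) : Matrix ι κ ℝ := Matrix.of fun i j => y (i, j)

theorem continuous_ofEntries : Continuous (ofEntries : (ι × κ → ℝ) → Matrix ι κ ℝ) :=
  continuous_matrix fun i j => continuous_apply (i, j)

theorem measurable_ofEntries_apply (i : ι) (j : κ) :
    Measurable fun y : ι × κ → ℝ => ofEntries y i j := measurable_pi_apply (i, j)

variable [Fintype ι] [Fintype κ]

/-- The law of the entries of a matrix with independent `N(M i j, 1)` entries. -/
noncomputable def gaussianEntries (M : Matrix ι κ ℝ) : Measure (ι × κ → ℝ) :=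
  Measure.pi fun a => gaussianReal (M a.1 a.2) 1

instance (M : Matrix ι κ ℝ) : IsProbabilityMeasure (gaussianEntries M) := by
  unfold gaussianEntries; infer_instance

theorem measurable_ridgeInv_apply [DecidableEq κ] (ε : ℝ) (k l : κ) :
    Measurable fun y : ι × κ → ℝ => ridgeInv ε (ofEntries y) k l := by
  refine measurable_matrix_inv_apply ?_ k l
  exact (continuous_ofEntries.matrix_transpose.matrix_mul continuous_ofEntries).add
    continuous_const

theorem measurable_ridgeInv_mulVec [DecidableEq κ] (ε : ℝ) (v : κ → ℝ) (j : κ) :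
    Measurable fun y : ι × κ → ℝ => (ridgeInv ε (ofEntries y) *ᵥ v) j :=
  measurable_mulVec_apply (w := fun _ => v) (measurable_ridgeInv_apply ε)
    (fun _ => measurable_const) j

theorem measurable_mulVec_ridgeInv_mulVec [DecidableEq κ] (ε : ℝ) (v : κ → ℝ) (i : ι) :
    Measurable fun y : ι × κ → ℝ => (ofEntries y *ᵥ (ridgeInv ε (ofEntries y) *ᵥ v)) i :=
  measurable_mulVec_apply measurable_ofEntries_apply (measurable_ridgeInv_mulVec ε v) i

theorem measurable_ridgePartial [DecidableEq κ] (ε : ℝ) (v : κ → ℝ) (i : ι) (j : κ) :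
    Measurable fun y : ι × κ → ℝ => ridgePartial ε v i j (ofEntries y) := by
  refine ((measurable_ridgeInv_mulVec ε v j).sub
    ((measurable_mulVec_ridgeInv_mulVec ε _ i).mul (measurable_mulVec_ridgeInv_mulVec ε v i))).sub
    (Measurable.mul ?_ (measurable_ridgeInv_mulVec ε v j))
  exact measurable_dotProduct (measurable_ofEntries_apply i)
    (measurable_mulVec_apply (measurable_ridgeInv_apply ε) (measurable_ofEntries_apply i))

variable (M : Matrix ι κ ℝ)

theorem memLp_ofEntries_sub (i : ι) (j : κ) :
    MemLp (fun y => ofEntries y i j - M i j) 2 (gaussianEntries M) := by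
  have h : MemLp (fun y : ι × κ → ℝ => y (i, j)) 2 (gaussianEntries M) :=
    (memLp_id_gaussianReal (μ := M i j) (v := 1) 2).comp_measurePreserving
      (measurePreserving_eval (fun a : ι × κ => gaussianReal (M a.1 a.2) 1) (i, j))
  exact h.sub (memLp_const _)

theorem integral_ofEntries_sub (i : ι) (j : κ) :
    ∫ y, (ofEntries y i j - M i j) ∂gaussianEntries M = 0 := by
  have hmp := measurePreserving_eval (fun a : ι × κ => gaussianReal (M a.1 a.2) 1) (i, j)
  have h := integral_map (μ := gaussianEntries M) hmp.measurable.aemeasurable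
    (f := fun t : ℝ => t - M i j) (by fun_prop)
  refine h.symm.trans ?_
  have hid : Integrable (fun t : ℝ => t) (gaussianReal (M i j) 1) :=
    (memLp_id_gaussianReal 1).integrable le_rfl
  have h0 : ∫ t : ℝ, (t - M i j) ∂gaussianReal (M i j) 1 = 0 := by
    rw [integral_sub hid (integrable_const _)]
    simp
  rw [gaussianEntries, hmp.map_eq]
  exact h0

theorem integral_ofEntries_sub_sq (i : ι) (j : κ) :
    ∫ y, (ofEntries y i j - M i j) ^ 2 ∂gaussianEntries M = 1 := by
  have hmp := measurePreserving_eval (fun a : ι × κ => gaussianReal (M a.1 a.2) 1) (i, j)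
  have h := integral_map (μ := gaussianEntries M) hmp.measurable.aemeasurable
    (f := fun t : ℝ => (t - M i j) ^ 2) (by fun_prop)
  refine h.symm.trans ?_
  have hv := variance_fun_id_gaussianReal (μ := M i j) (v := 1)
  rw [variance_eq_integral (by fun_prop)] at hv
  rw [gaussianEntries, hmp.map_eq]
  simpa using hv

theorem integral_ofEntries_sub_mul [DecidableEq κ] (i : ι) (j k : κ) :
    ∫ y, (ofEntries y i j - M i j) * (ofEntries y i k - M i k) ∂gaussianEntries M =
      if j = k then 1 else 0 := by
  split_ifs with h
  · subst h
    simpa [sq] using integral_ofEntries_sub_sq M i j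
  · have hi := iIndepFun_pi (μ := fun a : ι × κ => gaussianReal (M a.1 a.2) 1)
      (X := fun a t => t - M a.1 a.2) (fun a => by fun_prop)
    have := (hi.indepFun (i := (i, j)) (j := (i, k))
      (by simpa using h)).integral_fun_mul_eq_mul_integral
      (memLp_ofEntries_sub M i j).aestronglyMeasurable
      (memLp_ofEntries_sub M i k).aestronglyMeasurable
    refine this.trans ?_
    have h0 := integral_ofEntries_sub M i j
    exact mul_eq_zero_of_left h0 _

theorem memLp_sub_mulVec_add (w : κ → ℝ) (u : ι → ℝ) (i : ι) :
    MemLp (fun y => ((ofEntries y - M) *ᵥ w + u) i) 2 (gaussianEntries M) := by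
  refine MemLp.add ?_ (memLp_const _)
  exact memLp_finsetSum _ fun j _ => (memLp_ofEntries_sub M i j).mul_const (w j)

theorem integral_sub_mulVec_add_sq (w : κ → ℝ) (u : ι → ℝ) (i : ι) :
    ∫ y, ((ofEntries y - M) *ᵥ w + u) i ^ 2 ∂gaussianEntries M = w ⬝ᵥ w + u i ^ 2 := by
  classical
  have e : ∀ y, ((ofEntries y - M) *ᵥ w + u) i ^ 2 =
      (∑ j, ∑ k, (w j * w k) * ((ofEntries y i j - M i j) * (ofEntries y i k - M i k))) +
        (∑ j, 2 * u i * w j * (ofEntries y i j - M i j)) + u i ^ 2 := by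
    intro y
    simp only [Pi.add_apply, mulVec, dotProduct, Matrix.sub_apply]
    rw [add_sq, sq (∑ j, _), Finset.sum_mul_sum]
    congr 2
    · exact Finset.sum_congr rfl fun _ _ => Finset.sum_congr rfl fun _ _ => by ring
    · rw [Finset.mul_sum, Finset.sum_mul]
      exact Finset.sum_congr rfl fun _ _ => by ring
  have i1 : ∀ j k, Integrable (fun y => (w j * w k) *
      ((ofEntries y i j - M i j) * (ofEntries y i k - M i k))) (gaussianEntries M) :=
    fun j k => ((memLp_ofEntries_sub M i j).integrable_mul (memLp_ofEntries_sub M i k)).const_mul _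
  have i2 : ∀ j, Integrable (fun y => 2 * u i * w j * (ofEntries y i j - M i j))
      (gaussianEntries M) :=
    fun j => ((memLp_ofEntries_sub M i j).integrable one_le_two).const_mul _
  have i3 : Integrable (fun y => ∑ j, ∑ k, (w j * w k) *
      ((ofEntries y i j - M i j) * (ofEntries y i k - M i k))) (gaussianEntries M) :=
    integrable_finsetSum _ fun j _ => integrable_finsetSum _ fun k _ => i1 j k
  have i4 : Integrable (fun y => ∑ j, 2 * u i * w j * (ofEntries y i j - M i j))
      (gaussianEntries M) := integrable_finsetSum _ fun j _ => i2 j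
  have i5 : Integrable (fun y => (∑ j, ∑ k, (w j * w k) *
      ((ofEntries y i j - M i j) * (ofEntries y i k - M i k))) +
      ∑ j, 2 * u i * w j * (ofEntries y i j - M i j)) (gaussianEntries M) := i3.add i4
  simp only [e]
  rw [integral_add i5 (integrable_const _), integral_add i3 i4,
    integral_finsetSum _ (fun j _ => integrable_finsetSum _ fun k _ => i1 j k),
    integral_finsetSum _ (fun j _ => i2 j)]
  simp only [integral_finsetSum _ (fun k _ => i1 _ k), integral_const_mul,
    integral_ofEntries_sub_mul, integral_ofEntries_sub]
  simp [dotProduct]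

theorem integral_sub_mulVec_add_dotProduct_self (w : κ → ℝ) (u : ι → ℝ) :
    ∫ y, ((ofEntries y - M) *ᵥ w + u) ⬝ᵥ ((ofEntries y - M) *ᵥ w + u) ∂gaussianEntries M =
      Fintype.card ι * (w ⬝ᵥ w) + u ⬝ᵥ u := by
  have e : ∀ y, ((ofEntries y - M) *ᵥ w + u) ⬝ᵥ ((ofEntries y - M) *ᵥ w + u) =
      ∑ i, ((ofEntries y - M) *ᵥ w + u) i ^ 2 := fun y => by simp only [dotProduct, sq]
  simp only [e]
  rw [integral_finsetSum _ fun i _ => (memLp_sub_mulVec_add M w u i).integrable_sq]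
  simp only [integral_sub_mulVec_add_sq, Finset.sum_add_distrib]
  simp [dotProduct, sq]

theorem memLp_sub_mulVec (v : κ → ℝ) (i : ι) :
    MemLp (fun y => ((ofEntries y - M) *ᵥ v) i) 2 (gaussianEntries M) := by
  simpa using memLp_sub_mulVec_add M v 0 i

end gaussianMatrix

section ridge

variable {ι κ : Type*} [Fintype ι] [Fintype κ] [DecidableEq κ] (M : Matrix ι κ ℝ)

/-- The error, applied to `v`, of the regularized estimator `x (I - c (xᵀ x + ε I)⁻¹)`. -/
noncomputable def ridgeError (c ε : ℝ) (v : κ → ℝ) (x : Matrix ι κ ℝ) : ι → ℝ :=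
  (x - M) *ᵥ v - c • (x *ᵥ (ridgeInv ε x *ᵥ v))

theorem measurable_ridgeError (c ε : ℝ) (v : κ → ℝ) (i : ι) :
    Measurable fun y => ridgeError M c ε v (ofEntries y) i := by
  refine Measurable.sub ?_ ((measurable_mulVec_ridgeInv_mulVec ε v i).const_mul c)
  exact measurable_mulVec_apply (w := fun _ => v)
    (fun i j => (measurable_ofEntries_apply i j).sub_const _) (fun _ => measurable_const) i

variable {ε : ℝ}

theorem memLp_mulVec_ridgeInv (hε : 0 < ε) (v : κ → ℝ) (i : ι) :
    MemLp (fun y => (ofEntries y *ᵥ (ridgeInv ε (ofEntries y) *ᵥ v)) i) 2 (gaussianEntries M) :=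
  MemLp.of_bound (measurable_mulVec_ridgeInv_mulVec ε v i).aestronglyMeasurable
    (√(v ⬝ᵥ v / ε)) (ae_of_all _ fun _ => Real.abs_le_sqrt (sq_mulVec_ridgeInv_le hε _ v i))

theorem memLp_ridgeError (hε : 0 < ε) (c : ℝ) (v : κ → ℝ) (i : ι) :
    MemLp (fun y => ridgeError M c ε v (ofEntries y) i) 2 (gaussianEntries M) :=
  (memLp_sub_mulVec M v i).sub ((memLp_mulVec_ridgeInv M hε v i).const_mul c)

theorem integrable_ridgeInv_quadratic (hε : 0 < ε) (v : κ → ℝ) :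
    Integrable (fun y => v ⬝ᵥ (ridgeInv ε (ofEntries y) *ᵥ v)) (gaussianEntries M) := by
  refine Integrable.of_bound (measurable_dotProduct (v := fun _ => v) (fun _ => measurable_const)
    (measurable_ridgeInv_mulVec ε v)).aestronglyMeasurable (v ⬝ᵥ v / ε) (ae_of_all _ fun y => ?_)
  rw [Real.norm_of_nonneg (ridgeInv_quadratic_nonneg hε _ v), le_div_iff₀' hε]
  exact ridgeInv_quadratic_le hε _ v

/-- Stein's identity for the vector field `x (xᵀ x + ε I)⁻¹ v`. -/
theorem integral_sub_mulVec_dotProduct_ridge (hε : 0 < ε) (v : κ → ℝ) :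
    ∫ y, ((ofEntries y - M) *ᵥ v) ⬝ᵥ (ofEntries y *ᵥ (ridgeInv ε (ofEntries y) *ᵥ v))
        ∂gaussianEntries M =
      ∫ y, ∑ i, ∑ j, v j * ridgePartial ε v i j (ofEntries y) ∂gaussianEntries M := by
  classical
  obtain ⟨C, hC⟩ := exists_bound_ridge (ι := ι) hε v
  have stein : ∀ i j, ∫ y, (ofEntries y i j - M i j) *
      (ofEntries y *ᵥ (ridgeInv ε (ofEntries y) *ᵥ v)) i ∂gaussianEntries M =
      ∫ y, ridgePartial ε v i j (ofEntries y) ∂gaussianEntries M := by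
    intro i j
    refine integral_sub_mean_mul_pi_gaussianReal (m := fun a : ι × κ => M a.1 a.2) (C := C)
      (f := fun y => (ofEntries y *ᵥ (ridgeInv ε (ofEntries y) *ᵥ v)) i)
      (f' := fun y => ridgePartial ε v i j (ofEntries y)) (i, j) ?_
      (measurable_mulVec_ridgeInv_mulVec ε v i) (measurable_ridgePartial ε v i j)
      (fun y => (hC i j _).1) (fun y => (hC i j _).2)
    intro y t
    refine hasDerivAt_ridge (x := fun s => ofEntries (Function.update y (i, j) s)) hε v i j ?_
    intro a b
    by_cases h : (a, b) = (i, j)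
    · obtain ⟨rfl, rfl⟩ := Prod.mk.inj h
      simpa [ofEntries] using hasDerivAt_id' t
    · have h1 : Matrix.single i j (1 : ℝ) a b = 0 := by
        rw [Matrix.single_apply, if_neg]
        rintro ⟨rfl, rfl⟩; exact h rfl
      simpa [ofEntries, Function.update_of_ne h, h1] using hasDerivAt_const t (y (a, b))
  have i1 : ∀ i j, Integrable (fun y => v j * ((ofEntries y i j - M i j) *
      (ofEntries y *ᵥ (ridgeInv ε (ofEntries y) *ᵥ v)) i)) (gaussianEntries M) := fun i j =>
    ((memLp_ofEntries_sub M i j).integrable_mul (memLp_mulVec_ridgeInv M hε v i)).const_mul _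
  have i2 : ∀ i j, Integrable (fun y => v j * ridgePartial ε v i j (ofEntries y))
      (gaussianEntries M) := fun i j =>
    (Integrable.of_bound (measurable_ridgePartial ε v i j).aestronglyMeasurable C
      (ae_of_all _ fun y => (hC i j _).2)).const_mul _
  have e : ∀ y, ((ofEntries y - M) *ᵥ v) ⬝ᵥ (ofEntries y *ᵥ (ridgeInv ε (ofEntries y) *ᵥ v)) =
      ∑ i, ∑ j, v j * ((ofEntries y i j - M i j) *
        (ofEntries y *ᵥ (ridgeInv ε (ofEntries y) *ᵥ v)) i) := by
    intro y
    rw [dotProduct]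
    refine Finset.sum_congr rfl fun i _ => ?_
    conv_lhs => rw [mulVec, dotProduct, Finset.sum_mul]
    exact Finset.sum_congr rfl fun j _ => by rw [Matrix.sub_apply]; ring
  simp only [e]
  rw [integral_finsetSum _ fun i _ => integrable_finsetSum _ fun j _ => i1 i j,
    integral_finsetSum _ fun i _ => integrable_finsetSum _ fun j _ => i2 i j]
  refine Finset.sum_congr rfl fun i _ => ?_
  rw [integral_finsetSum _ fun j _ => i1 i j, integral_finsetSum _ fun j _ => i2 i j]
  refine Finset.sum_congr rfl fun j _ => ?_
  rw [integral_const_mul, integral_const_mul, stein]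

theorem integrable_sum_ridgePartial (hε : 0 < ε) (v : κ → ℝ) :
    Integrable (fun y => ∑ i, ∑ j, v j * ridgePartial ε v i j (ofEntries y))
      (gaussianEntries M) := by
  obtain ⟨C, hC⟩ := exists_bound_ridge (ι := ι) hε v
  exact integrable_finsetSum _ fun i _ => integrable_finsetSum _ fun j _ =>
    (Integrable.of_bound (measurable_ridgePartial ε v i j).aestronglyMeasurable C
      (ae_of_all _ fun y => (hC i j _).2)).const_mul _

/-- The risk bound for the regularized Efron–Morris estimator. -/
theorem integral_ridgeError_sq_le (hε : 0 < ε) (v : κ → ℝ) {c : ℝ} (hc0 : 0 ≤ c)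
    (hc : c = (Fintype.card ι : ℝ) - Fintype.card κ - 1) :
    ∫ y, ridgeError M c ε v (ofEntries y) ⬝ᵥ ridgeError M c ε v (ofEntries y)
        ∂gaussianEntries M ≤
      Fintype.card ι * (v ⬝ᵥ v) -
        c ^ 2 * ∫ y, v ⬝ᵥ (ridgeInv ε (ofEntries y) *ᵥ v) ∂gaussianEntries M := by
  set μ := gaussianEntries M
  set z : (ι × κ → ℝ) → ι → ℝ := fun y => (ofEntries y - M) *ᵥ v
  set g : (ι × κ → ℝ) → ι → ℝ := fun y => ofEntries y *ᵥ (ridgeInv ε (ofEntries y) *ᵥ v)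
  set q : (ι × κ → ℝ) → ℝ := fun y => v ⬝ᵥ (ridgeInv ε (ofEntries y) *ᵥ v)
  have hq : Integrable q μ := integrable_ridgeInv_quadratic M hε v
  have hzz : Integrable (fun y => z y ⬝ᵥ z y) μ :=
    integrable_dotProduct_self (memLp_sub_mulVec M v)
  have hgg : Integrable (fun y => g y ⬝ᵥ g y) μ :=
    integrable_dotProduct_self (memLp_mulVec_ridgeInv M hε v)
  have hzg : Integrable (fun y => z y ⬝ᵥ g y) μ := integrable_finsetSum _ fun i _ =>
    (memLp_sub_mulVec M v i).integrable_mul (memLp_mulVec_ridgeInv M hε v i)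
  have ezz : ∫ y, z y ⬝ᵥ z y ∂μ = Fintype.card ι * (v ⬝ᵥ v) := by
    simpa using integral_sub_mulVec_add_dotProduct_self M v 0
  have ezg : c * ∫ y, q y ∂μ ≤ ∫ y, z y ⬝ᵥ g y ∂μ := by
    rw [integral_sub_mulVec_dotProduct_ridge M hε v, ← integral_const_mul]
    refine integral_mono (hq.const_mul c) (integrable_sum_ridgePartial M hε v) fun y => ?_
    rw [hc]
    exact le_sum_ridgePartial hε v _
  have egg : ∫ y, g y ⬝ᵥ g y ∂μ ≤ ∫ y, q y ∂μ := by
    refine integral_mono hgg hq fun y => ?_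
    have h1 := dotProduct_ridgeInv_mulVec hε (ofEntries y) v v
    have h2 := dotProduct_self_nonneg_real (ridgeInv ε (ofEntries y) *ᵥ v)
    simp only [q, g]
    nlinarith [mul_nonneg hε.le h2]
  have e : ∀ y, ridgeError M c ε v (ofEntries y) ⬝ᵥ ridgeError M c ε v (ofEntries y) =
      (z y ⬝ᵥ z y - 2 * c * (z y ⬝ᵥ g y)) + c ^ 2 * (g y ⬝ᵥ g y) := by
    intro y
    change (z y - c • g y) ⬝ᵥ (z y - c • g y) = _
    simp only [sub_dotProduct, dotProduct_sub, smul_dotProduct, dotProduct_smul, smul_eq_mul,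
      dotProduct_comm (g y) (z y)]
    ring
  have hd : Integrable (fun y => z y ⬝ᵥ z y - 2 * c * (z y ⬝ᵥ g y)) μ :=
    hzz.sub (hzg.const_mul _)
  simp only [e]
  rw [integral_add hd (hgg.const_mul _), integral_sub hzz (hzg.const_mul _), integral_const_mul,
    integral_const_mul, ezz]
  nlinarith [mul_le_mul_of_nonneg_left ezg hc0, mul_le_mul_of_nonneg_left egg (sq_nonneg c)]

theorem sq_mul_integral_ridgeInv_quadratic_le (hε : 0 < ε) (v : κ → ℝ) {c : ℝ} (hc0 : 0 ≤ c)
    (hc : c = (Fintype.card ι : ℝ) - Fintype.card κ - 1) :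
    c ^ 2 * ∫ y, v ⬝ᵥ (ridgeInv ε (ofEntries y) *ᵥ v) ∂gaussianEntries M ≤
      Fintype.card ι * (v ⬝ᵥ v) := by
  have h1 := integral_ridgeError_sq_le M hε v hc0 hc
  have h2 : 0 ≤ ∫ y, ridgeError M c ε v (ofEntries y) ⬝ᵥ ridgeError M c ε v (ofEntries y)
      ∂gaussianEntries M := integral_nonneg fun y => dotProduct_self_nonneg_real _
  linarith

theorem inv_le_trace_ridgeInv (hε : 0 < ε) {x : Matrix ι κ ℝ} (hx : (xᵀ * x).det = 0) :
    ε⁻¹ ≤ ∑ j, (Pi.single j 1 : κ → ℝ) ⬝ᵥ (ridgeInv ε x *ᵥ Pi.single j 1) := by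
  obtain ⟨u, hu0, hu⟩ := Matrix.exists_mulVec_eq_zero_iff.2 hx
  have hxu : x *ᵥ u = 0 := by
    have h : (x *ᵥ u) ⬝ᵥ (x *ᵥ u) = 0 := by
      have h1 := congrArg (u ⬝ᵥ ·) hu
      simp only [← mulVec_mulVec, dotProduct_zero] at h1
      rw [dotProduct_mulVec, vecMul_transpose] at h1
      exact h1
    exact dotProduct_self_eq_zero.1 h
  have hN : 0 < u ⬝ᵥ u := lt_of_le_of_ne (dotProduct_self_nonneg_real u)
    fun h => hu0 (dotProduct_self_eq_zero.1 h.symm)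
  set N := u ⬝ᵥ u with hNdef
  have h : ∀ j, u j * u j / (ε * N) ≤
      (Pi.single j 1 : κ → ℝ) ⬝ᵥ (ridgeInv ε x *ᵥ Pi.single j 1) := by
    intro j
    refine le_trans (le_of_eq ?_) (le_ridgeInv_quadratic hε x (Pi.single j 1)
      ((u j / (ε * N)) • u))
    simp only [mulVec_smul, hxu, smul_zero, dotProduct_smul, smul_dotProduct, ← hNdef,
      dotProduct_zero, zero_add, smul_eq_mul, single_dotProduct, one_mul]
    field_simp
    ring
  refine le_trans (le_of_eq ?_) (Finset.sum_le_sum fun j _ => h j)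
  rw [← Finset.sum_div, show ∑ j, u j * u j = N from rfl]
  field_simp

/-- The Gram matrix of a Gaussian matrix with enough rows is almost surely invertible. -/
theorem ae_det_gram_ne_zero {c : ℝ} (hc0 : 0 < c)
    (hc : c = (Fintype.card ι : ℝ) - Fintype.card κ - 1) :
    ∀ᵐ y ∂gaussianEntries M, ((ofEntries y)ᵀ * ofEntries y).det ≠ 0 := by
  set μ := gaussianEntries M
  set N : Set (ι × κ → ℝ) := {y | ((ofEntries y)ᵀ * ofEntries y).det = 0} with hN
  suffices h : μ.real N = 0 by
    rw [ae_iff]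
    simpa [hN] using (measureReal_eq_zero_iff).1 h
  set B : ℝ := ∑ _j : κ, (Fintype.card ι : ℝ) / c ^ 2 with hB
  have key : ∀ ε : ℝ, 0 < ε → μ.real N ≤ ε * B := by
    intro ε hε
    set T : (ι × κ → ℝ) → ℝ := fun y =>
      ∑ j, (Pi.single j 1 : κ → ℝ) ⬝ᵥ (ridgeInv ε (ofEntries y) *ᵥ Pi.single j 1)
    have hT : Integrable T μ :=
      integrable_finsetSum _ fun j _ => integrable_ridgeInv_quadratic M hε _
    have hT0 : 0 ≤ᵐ[μ] T := ae_of_all _ fun y =>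
      Finset.sum_nonneg fun j _ => ridgeInv_quadratic_nonneg hε _ _
    have hTB : ∫ y, T y ∂μ ≤ B := by
      rw [integral_finsetSum _ fun j _ => integrable_ridgeInv_quadratic M hε _]
      refine Finset.sum_le_sum fun j _ => ?_
      rw [le_div_iff₀' (by positivity)]
      simpa using sq_mul_integral_ridgeInv_quadratic_le M hε (Pi.single j 1) hc0.le hc
    have h1 := mul_meas_ge_le_integral_of_nonneg hT0 hT ε⁻¹
    have h2 : μ.real N ≤ μ.real {y | ε⁻¹ ≤ T y} :=
      measureReal_mono fun y hy => inv_le_trace_ridgeInv hε hy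
    have h3 : ε⁻¹ * μ.real N ≤ B :=
      (mul_le_mul_of_nonneg_left h2 (by positivity)).trans (h1.trans hTB)
    rwa [inv_mul_le_iff₀ hε] at h3
  have hB0 : 0 ≤ B := Finset.sum_nonneg fun _ _ => by positivity
  refine le_antisymm (le_of_forall_pos_le_add fun δ hδ => ?_) measureReal_nonneg
  refine (key (δ / (B + 1)) (by positivity)).trans ?_
  rw [zero_add, div_mul_eq_mul_div, div_le_iff₀ (by positivity)]
  nlinarith

/-- Jensen's inequality for the inverse of the regularized Gram matrix. -/
theorem le_integral_ridgeInv_quadratic (hε : 0 < ε) (v w : κ → ℝ) :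
    2 * (v ⬝ᵥ w) - (Fintype.card ι * (w ⬝ᵥ w) + (M *ᵥ w) ⬝ᵥ (M *ᵥ w) + ε * (w ⬝ᵥ w)) ≤
      ∫ y, v ⬝ᵥ (ridgeInv ε (ofEntries y) *ᵥ v) ∂gaussianEntries M := by
  have e : ∀ y : ι × κ → ℝ, (ofEntries y - M) *ᵥ w + M *ᵥ w = ofEntries y *ᵥ w := fun y => by
    rw [sub_mulVec, sub_add_cancel]
  have h1 := integral_sub_mulVec_add_dotProduct_self M w (M *ᵥ w)
  have h2 := integrable_dotProduct_self fun i => memLp_sub_mulVec_add M w (M *ᵥ w) i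
  simp only [e] at h1 h2
  have h3 : Integrable (fun y : ι × κ → ℝ => (ofEntries y *ᵥ w) ⬝ᵥ (ofEntries y *ᵥ w) +
      ε * (w ⬝ᵥ w)) (gaussianEntries M) := h2.add (integrable_const _)
  have h4 := integral_mono ((integrable_const (2 * (v ⬝ᵥ w))).sub h3)
    (integrable_ridgeInv_quadratic M hε v) fun y => le_ridgeInv_quadratic hε (ofEntries y) v w
  simp only [Pi.sub_apply] at h4
  rw [integral_sub (integrable_const _) h3, integral_add h2 (integrable_const _), h1] at h4
  simpa using h4

/-- The risk bound for the Efron–Morris estimator, in terms of any test vector `w`. -/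
theorem lintegral_ridgeError_zero_le {c : ℝ} (hc0 : 0 < c)
    (hc : c = (Fintype.card ι : ℝ) - Fintype.card κ - 1) (v w : κ → ℝ) :
    ∫⁻ y, ENNReal.ofReal (ridgeError M c 0 v (ofEntries y) ⬝ᵥ ridgeError M c 0 v (ofEntries y))
        ∂gaussianEntries M ≤
      ENNReal.ofReal (Fintype.card ι * (v ⬝ᵥ v) - c ^ 2 * (2 * (v ⬝ᵥ w) -
        (Fintype.card ι * (w ⬝ᵥ w) + (M *ᵥ w) ⬝ᵥ (M *ᵥ w)))) := by
  set μ := gaussianEntries M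
  set ε : ℕ → ℝ := fun k => 1 / ((k : ℝ) + 1)
  have hε : ∀ k, 0 < ε k := fun k => by positivity
  have hε0 : Filter.Tendsto ε Filter.atTop (nhds 0) := tendsto_one_div_add_atTop_nhds_zero_nat
  set L : ℝ → (ι × κ → ℝ) → ℝ := fun ε y =>
    ridgeError M c ε v (ofEntries y) ⬝ᵥ ridgeError M c ε v (ofEntries y)
  set b : ℝ → ℝ := fun ε => Fintype.card ι * (v ⬝ᵥ v) - c ^ 2 * (2 * (v ⬝ᵥ w) -
        (Fintype.card ι * (w ⬝ᵥ w) + (M *ᵥ w) ⬝ᵥ (M *ᵥ w) + ε * (w ⬝ᵥ w)))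
  have hlim : ∀ᵐ y ∂μ, ENNReal.ofReal (L 0 y) =
      Filter.liminf (fun k => ENNReal.ofReal (L (ε k) y)) Filter.atTop := by
    filter_upwards [ae_det_gram_ne_zero M hc0 hc] with y hy
    refine (Filter.Tendsto.liminf_eq (ENNReal.tendsto_ofReal ?_)).symm
    have hR : Filter.Tendsto (fun k => ridgeInv (ε k) (ofEntries y)) Filter.atTop
        (nhds (ridgeInv 0 (ofEntries y))) := by
      have := (tendsto_inv_add_smul_one hy).comp hε0
      simpa [ridgeInv, Function.comp_def] using this
    have hcont : Continuous fun R : Matrix κ κ ℝ =>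
        ((ofEntries y - M) *ᵥ v - c • (ofEntries y *ᵥ (R *ᵥ v))) ⬝ᵥ
          ((ofEntries y - M) *ᵥ v - c • (ofEntries y *ᵥ (R *ᵥ v))) := by
      have h1 : Continuous fun R : Matrix κ κ ℝ =>
          (ofEntries y - M) *ᵥ v - c • (ofEntries y *ᵥ (R *ᵥ v)) :=
        continuous_const.sub ((continuous_const.matrix_mulVec
          (continuous_id.matrix_mulVec continuous_const)).const_smul c)
      exact h1.dotProduct h1
    exact (hcont.tendsto _).comp hR
  have hb : Filter.Tendsto (fun k => ENNReal.ofReal (b (ε k))) Filter.atTop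
      (nhds (ENNReal.ofReal (b 0))) := by
    have : Continuous b := by fun_prop
    exact ENNReal.tendsto_ofReal ((this.tendsto 0).comp hε0)
  have hle : ∀ k, ∫⁻ y, ENNReal.ofReal (L (ε k) y) ∂μ ≤ ENNReal.ofReal (b (ε k)) := by
    intro k
    rw [← ofReal_integral_eq_lintegral_ofReal
      (integrable_dotProduct_self (memLp_ridgeError M (hε k) c v))
      (ae_of_all _ fun y => dotProduct_self_nonneg_real _)]
    refine ENNReal.ofReal_le_ofReal ((integral_ridgeError_sq_le M (hε k) v hc0.le hc).trans ?_)
    have := le_integral_ridgeInv_quadratic M (hε k) v w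
    simp only [b]
    gcongr
  have hmeas : ∀ k, Measurable fun y => ENNReal.ofReal (L (ε k) y) := fun k =>
    (measurable_dotProduct (measurable_ridgeError M c (ε k) v)
      (measurable_ridgeError M c (ε k) v)).ennreal_ofReal
  have hb0 : b 0 = Fintype.card ι * (v ⬝ᵥ v) - c ^ 2 * (2 * (v ⬝ᵥ w) -
        (Fintype.card ι * (w ⬝ᵥ w) + (M *ᵥ w) ⬝ᵥ (M *ᵥ w))) := by simp [b]
  rw [← hb0]
  calc ∫⁻ y, ENNReal.ofReal (L 0 y) ∂μ
      = ∫⁻ y, Filter.liminf (fun k => ENNReal.ofReal (L (ε k) y)) Filter.atTop ∂μ :=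
        lintegral_congr_ae hlim
    _ ≤ Filter.liminf (fun k => ∫⁻ y, ENNReal.ofReal (L (ε k) y) ∂μ) Filter.atTop :=
        lintegral_liminf_le hmeas
    _ ≤ Filter.liminf (fun k => ENNReal.ofReal (b (ε k))) Filter.atTop :=
        Filter.liminf_le_liminf (Filter.Eventually.of_forall hle)
    _ = ENNReal.ofReal (b 0) := hb.liminf_eq

end ridge

section risk

variable {n p : ℕ}

theorem dotProduct_matrixQuadraticLoss_mulVec (M Mhat : Matrix (Fin n) (Fin p) ℝ)
    (v : Fin p → ℝ) :
    v ⬝ᵥ (matrixQuadraticLoss M Mhat *ᵥ v) = ((Mhat - M) *ᵥ v) ⬝ᵥ ((Mhat - M) *ᵥ v) := by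
  rw [matrixQuadraticLoss, ← mulVec_mulVec, dotProduct_mulVec, vecMul_transpose]

theorem isHermitian_matrixQuadraticRisk {Ω : Type*} [MeasurableSpace Ω] (P : Measure Ω)
    (X : Ω → Matrix (Fin n) (Fin p) ℝ) (M : Matrix (Fin n) (Fin p) ℝ)
    (δ : Matrix (Fin n) (Fin p) ℝ → Matrix (Fin n) (Fin p) ℝ) :
    (matrixQuadraticRisk P X M δ).IsHermitian := by
  refine Matrix.IsHermitian.ext fun i j => ?_
  simp only [matrixQuadraticRisk, matrixExpectation, Matrix.of_apply, star_trivial]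
  congr 1
  ext ω
  simp only [matrixQuadraticLoss, Matrix.mul_apply, Matrix.transpose_apply, mul_comm]

theorem HasFiniteMatrixRisk.dotProduct_risk_mulVec {Ω : Type*} [MeasurableSpace Ω]
    {P : Measure Ω} {X : Ω → Matrix (Fin n) (Fin p) ℝ} {M : Matrix (Fin n) (Fin p) ℝ}
    {δ : Matrix (Fin n) (Fin p) ℝ → Matrix (Fin n) (Fin p) ℝ}
    (h : HasFiniteMatrixRisk P X M δ) (v : Fin p → ℝ) :
    v ⬝ᵥ (matrixQuadraticRisk P X M δ *ᵥ v) =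
      ∫ ω, ((δ (X ω) - M) *ᵥ v) ⬝ᵥ ((δ (X ω) - M) *ᵥ v) ∂P := by
  have i1 : ∀ i j, Integrable (fun ω => v i * (matrixQuadraticLoss M (δ (X ω)) i j * v j)) P :=
    fun i j => ((h i j).mul_const _).const_mul _
  simp only [← dotProduct_matrixQuadraticLoss_mulVec]
  simp only [dotProduct, mulVec, Finset.mul_sum]
  rw [integral_finsetSum _ fun i _ => integrable_finsetSum _ fun j _ => i1 i j]
  refine Finset.sum_congr rfl fun i _ => ?_
  rw [integral_finsetSum _ fun j _ => i1 i j]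
  refine Finset.sum_congr rfl fun j _ => ?_
  rw [integral_const_mul, integral_mul_const]
  rfl

theorem hasFiniteMatrixRisk_of_memLp {Ω : Type*} [MeasurableSpace Ω]
    {P : Measure Ω} {X : Ω → Matrix (Fin n) (Fin p) ℝ} {M : Matrix (Fin n) (Fin p) ℝ}
    {δ : Matrix (Fin n) (Fin p) ℝ → Matrix (Fin n) (Fin p) ℝ}
    (h : ∀ i j, MemLp (fun ω => (δ (X ω) - M) i j) 2 P) : HasFiniteMatrixRisk P X M δ :=
  fun i j => by
    simp only [matrixQuadraticLoss, Matrix.mul_apply, Matrix.transpose_apply]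
    exact integrable_finsetSum _ fun k _ => (h k i).integrable_mul (h k j)

theorem efronMorris_sub_mulVec (M x : Matrix (Fin n) (Fin p) ℝ) (v : Fin p → ℝ) :
    (efronMorris x - M) *ᵥ v = ridgeError M ((n : ℝ) - p - 1) 0 v x := by
  rw [efronMorris, ridgeError, ridgeInv, zero_smul, add_zero, Matrix.mul_sub, Matrix.mul_one,
    sub_mulVec, sub_mulVec, sub_mulVec, Matrix.mul_smul, smul_mulVec, mulVec_mulVec]
  abel

theorem oracleCoeff_mulVec (hn : 0 < n) (M : Matrix (Fin n) (Fin p) ℝ) (v : Fin p → ℝ) :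
    oracleCoeff M *ᵥ v = v - (n : ℝ) • (ridgeInv (n : ℝ) M *ᵥ v) := by
  have hn' : (0 : ℝ) < n := by exact_mod_cast hn
  have h : ridgeInv (n : ℝ) M * (Mᵀ * M + (n : ℝ) • (1 : Matrix (Fin p) (Fin p) ℝ)) = 1 :=
    Matrix.nonsing_inv_mul _ ((Matrix.isUnit_iff_isUnit_det _).1 (isUnit_gram_add_smul_one hn' M))
  have h2 := congrArg (· *ᵥ v) h
  simp only [mul_add, mul_smul_comm, mul_one, add_mulVec, smul_mulVec, one_mulVec] at h2
  exact eq_sub_of_add_eq h2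

theorem linearEstimator_oracle_sub_mulVec (hn : 0 < n) (M x : Matrix (Fin n) (Fin p) ℝ)
    (v : Fin p → ℝ) :
    (linearEstimator (oracleCoeff M) x - M) *ᵥ v =
      (x - M) *ᵥ (v - (n : ℝ) • (ridgeInv (n : ℝ) M *ᵥ v)) +
        -((n : ℝ) • (M *ᵥ (ridgeInv (n : ℝ) M *ᵥ v))) := by
  rw [linearEstimator, sub_mulVec, ← mulVec_mulVec, oracleCoeff_mulVec hn, sub_mulVec x M,
    mulVec_sub M, mulVec_smul M]
  abel

theorem integral_oracle_error_sq (hn : 0 < n) (M : Matrix (Fin n) (Fin p) ℝ) (v : Fin p → ℝ) :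
    ∫ y, ((linearEstimator (oracleCoeff M) (ofEntries y) - M) *ᵥ v) ⬝ᵥ
        ((linearEstimator (oracleCoeff M) (ofEntries y) - M) *ᵥ v) ∂gaussianEntries M =
      n * (v ⬝ᵥ v) - (n : ℝ) ^ 2 * (v ⬝ᵥ (ridgeInv (n : ℝ) M *ᵥ v)) := by
  have hn' : (0 : ℝ) < n := by exact_mod_cast hn
  simp only [linearEstimator_oracle_sub_mulVec hn]
  rw [integral_sub_mulVec_add_dotProduct_self, dotProduct_ridgeInv_mulVec hn' M v v]
  have h := dotProduct_ridgeInv_mulVec hn' M v v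
  simp only [sub_dotProduct, dotProduct_sub, smul_dotProduct, dotProduct_smul, smul_eq_mul,
    neg_dotProduct, dotProduct_neg, Fintype.card_fin,
    dotProduct_comm (ridgeInv (n : ℝ) M *ᵥ v) v]
  rw [h]
  ring

theorem memLp_oracle_error (hn : 0 < n) (M : Matrix (Fin n) (Fin p) ℝ) (v : Fin p → ℝ)
    (i : Fin n) :
    MemLp (fun y => ((linearEstimator (oracleCoeff M) (ofEntries y) - M) *ᵥ v) i) 2
      (gaussianEntries M) := by
  simp only [linearEstimator_oracle_sub_mulVec hn]
  exact memLp_sub_mulVec_add M _ _ i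

theorem lintegral_efronMorris_error_sq_le (hnp : p + 1 < n) (M : Matrix (Fin n) (Fin p) ℝ)
    (v : Fin p → ℝ) :
    ∫⁻ y, ENNReal.ofReal (((efronMorris (ofEntries y) - M) *ᵥ v) ⬝ᵥ
        ((efronMorris (ofEntries y) - M) *ᵥ v)) ∂gaussianEntries M ≤
      ENNReal.ofReal (n * (v ⬝ᵥ v) -
        ((n : ℝ) - p - 1) ^ 2 * (v ⬝ᵥ (ridgeInv (n : ℝ) M *ᵥ v))) := by
  have hn' : (0 : ℝ) < n := by exact_mod_cast (show 0 < n by omega)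
  have hc : (0 : ℝ) < (n : ℝ) - p - 1 := by
    have : (p : ℝ) + 1 < n := by exact_mod_cast hnp
    linarith
  have h := lintegral_ridgeError_zero_le M hc (by simp) v (ridgeInv (n : ℝ) M *ᵥ v)
  simp only [efronMorris_sub_mulVec]
  refine h.trans (ENNReal.ofReal_le_ofReal (le_of_eq ?_))
  have h1 := dotProduct_ridgeInv_mulVec hn' M v v
  rw [Fintype.card_fin, h1]
  ring

theorem memLp_efronMorris_error (hnp : p + 1 < n) (M : Matrix (Fin n) (Fin p) ℝ)
    (v : Fin p → ℝ) (i : Fin n) :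
    MemLp (fun y => ((efronMorris (ofEntries y) - M) *ᵥ v) i) 2 (gaussianEntries M) := by
  have hm : Measurable fun y => ((efronMorris (ofEntries y) - M) *ᵥ v) i := by
    simp only [efronMorris_sub_mulVec]
    exact measurable_ridgeError M _ 0 v i
  rw [memLp_two_iff_integrable_sq hm.aestronglyMeasurable]
  refine ⟨(hm.pow_const 2).aestronglyMeasurable, ?_⟩
  rw [hasFiniteIntegral_iff_ofReal (ae_of_all _ fun y => sq_nonneg _)]
  refine lt_of_le_of_lt (lintegral_mono fun y => ENNReal.ofReal_le_ofReal
    (sq_apply_le_dotProduct_self _ i)) ?_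
  exact (lintegral_efronMorris_error_sq_le hnp M v).trans_lt ENNReal.ofReal_lt_top

theorem integral_efronMorris_error_sq_le (hnp : p + 1 < n) (M : Matrix (Fin n) (Fin p) ℝ)
    (v : Fin p → ℝ) :
    ∫ y, ((efronMorris (ofEntries y) - M) *ᵥ v) ⬝ᵥ ((efronMorris (ofEntries y) - M) *ᵥ v)
        ∂gaussianEntries M ≤
      n * (v ⬝ᵥ v) - ((n : ℝ) - p - 1) ^ 2 * (v ⬝ᵥ (ridgeInv (n : ℝ) M *ᵥ v)) := by
  have hn' : (0 : ℝ) < n := by exact_mod_cast (show 0 < n by omega)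
  have hc : (p : ℝ) + 1 < n := by exact_mod_cast hnp
  have hp : (0 : ℝ) ≤ p := Nat.cast_nonneg p
  have h := lintegral_efronMorris_error_sq_le hnp M v
  rw [← ofReal_integral_eq_lintegral_ofReal
    (integrable_dotProduct_self (memLp_efronMorris_error hnp M v))
    (ae_of_all _ fun y => dotProduct_self_nonneg_real _)] at h
  refine (ENNReal.ofReal_le_ofReal_iff ?_).1 h
  have h1 := ridgeInv_quadratic_le hn' M v
  have h2 := ridgeInv_quadratic_nonneg hn' M v
  have h3 : ((n : ℝ) - p - 1) ^ 2 ≤ (n : ℝ) ^ 2 := by nlinarith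
  nlinarith [mul_le_mul_of_nonneg_right h3 h2, mul_le_mul_of_nonneg_left h1 hn'.le]

theorem integral_efronMorris_error_sq_le_oracle (hnp : p + 1 < n) (M : Matrix (Fin n) (Fin p) ℝ)
    (v : Fin p → ℝ) :
    ∫ y, ((efronMorris (ofEntries y) - M) *ᵥ v) ⬝ᵥ ((efronMorris (ofEntries y) - M) *ᵥ v)
        ∂gaussianEntries M ≤
      ∫ y, ((linearEstimator (oracleCoeff M) (ofEntries y) - M) *ᵥ v) ⬝ᵥ
        ((linearEstimator (oracleCoeff M) (ofEntries y) - M) *ᵥ v) ∂gaussianEntries M +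
        2 * ((p : ℝ) + 1) * (v ⬝ᵥ v) := by
  have hn : 0 < n := by omega
  have hn' : (0 : ℝ) < n := by exact_mod_cast hn
  have hp : (0 : ℝ) ≤ p := Nat.cast_nonneg p
  rw [integral_oracle_error_sq hn]
  refine (integral_efronMorris_error_sq_le hnp M v).trans ?_
  have h1 := mul_le_mul_of_nonneg_left (ridgeInv_quadratic_le hn' M v)
    (show (0 : ℝ) ≤ 2 * ((p : ℝ) + 1) by positivity)
  have h2 := mul_nonneg (sq_nonneg ((p : ℝ) + 1)) (ridgeInv_quadratic_nonneg hn' M v)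
  nlinarith

theorem memLp_entry_of_mulVec {α : Type*} [MeasurableSpace α] {μ : Measure α}
    {D : α → Matrix (Fin n) (Fin p) ℝ}
    (h : ∀ v i, MemLp (fun a => (D a *ᵥ v) i) 2 μ) (i : Fin n) (j : Fin p) :
    MemLp (fun a => D a i j) 2 μ := by
  simpa using h (Pi.single j 1) i

end risk

theorem mainTheorem3 {Ω : Type*} [MeasurableSpace Ω] (P : Measure Ω) [IsProbabilityMeasure P]
    (n p : ℕ) (hnp : p + 1 < n)
    (M : Matrix (Fin n) (Fin p) ℝ)
    (X : Ω → Matrix (Fin n) (Fin p) ℝ)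
    (hlaw : ∀ i j, HasLaw (fun ω => X ω i j) (gaussianReal (M i j) 1) P)
    (hindep : iIndepFun (fun (ij : Fin n × Fin p) ω => X ω ij.1 ij.2) P) :
    HasFiniteMatrixRisk P X M efronMorris ∧
    HasFiniteMatrixRisk P X M (linearEstimator (oracleCoeff M)) ∧
    matrixQuadraticRisk P X M efronMorris ≤
      matrixQuadraticRisk P X M (linearEstimator (oracleCoeff M)) +
        (2 * ((p : ℝ) + 1)) • (1 : Matrix (Fin p) (Fin p) ℝ) := by
  have hY : HasLaw (fun ω (a : Fin n × Fin p) => X ω a.1 a.2) (gaussianEntries M) P :=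
    hindep.hasLaw_pi fun a => hlaw a.1 a.2
  have transfer : ∀ δ : Matrix (Fin n) (Fin p) ℝ → Matrix (Fin n) (Fin p) ℝ,
      (∀ v i, MemLp (fun y => ((δ (ofEntries y) - M) *ᵥ v) i) 2 (gaussianEntries M)) →
      HasFiniteMatrixRisk P X M δ ∧ ∀ v, v ⬝ᵥ (matrixQuadraticRisk P X M δ *ᵥ v) =
        ∫ y, ((δ (ofEntries y) - M) *ᵥ v) ⬝ᵥ ((δ (ofEntries y) - M) *ᵥ v)
          ∂gaussianEntries M := by
    intro δ hδ
    have hfin : HasFiniteMatrixRisk P X M δ := by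
      refine hasFiniteMatrixRisk_of_memLp fun i j => ?_
      have h := memLp_entry_of_mulVec hδ i j
      rw [← hY.map_eq] at h
      exact h.comp_of_map hY.aemeasurable
    refine ⟨hfin, fun v => ?_⟩
    rw [hfin.dotProduct_risk_mulVec]
    exact hY.integral_comp (integrable_dotProduct_self (hδ v)).aestronglyMeasurable
  obtain ⟨hE, hE'⟩ := transfer efronMorris (memLp_efronMorris_error hnp M)
  obtain ⟨hO, hO'⟩ := transfer _ (memLp_oracle_error (by omega) M)
  refine ⟨hE, hO, ?_⟩
  rw [Matrix.le_iff]
  refine Matrix.PosSemidef.of_dotProduct_mulVec_nonneg ?_ fun v => ?_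
  · exact ((isHermitian_matrixQuadraticRisk P X M _).add (by simp [Matrix.IsHermitian])).sub
      (isHermitian_matrixQuadraticRisk P X M _)
  · rw [star_trivial, sub_mulVec, add_mulVec, dotProduct_sub, dotProduct_add, hE', hO',
      smul_mulVec, one_mulVec, dotProduct_smul, smul_eq_mul, sub_nonneg]
    exact integral_efronMorris_error_sq_le_oracle hnp M v
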